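/- Let $\mathcal S$ be a connected closed triangular mesh of genus zero in $\mathbb R^3$ with nondegenerate triangles and vertices $v_1,\dots,v_n$, and let $L_D\in\mathbb R^{n\times n}$ be its cotangent Laplacian: $[L_D]_{ij}=w_{ij}=-\tfrac12(\cot\alpha_{ij}+\cot\alpha_{ji})$ if $[v_i,v_j]$ is an edge, where $\alpha_{ij},\alpha_{ji}$ are the two angles opposite to this edge; $[L_D]_{ii}=-\sum_{\ell\ne i}w_{i\ell}$; and $[L_D]_{ij}=0$ otherwise. Let $f_1,\dots,f_n\in\mathbb S^2$ be the images of the vertices under an initial spherical map, let $h^{(1)}_i\in\mathbb C\cup\{\infty\}$ be the image of $f_i$ under stereographic projection from the north pole, and let $\rho_0>1$ be a radius. For an index set $\mathtt I$ let its boundary be the set of all $j\notin\mathtt I$ such that $[v_i,v_j]$ is an edge for some $i\in\mathtt I$. Put $\mathtt I_1=\{i: |h^{(1)}_i|<\rho_0\}$ and let $\mathtt B_1$ be its boundary; assume $h^{(1)}_j\neq\infty$ for $j\in\mathtt B_1$. Let $h_i=h_i^{(1)}$ for $i\notin\mathtt I_1$, let $h_{\mathtt I_1}=-L_1^{-1}B_1h^{(1)}_{\mathtt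 B_1}$, and let $h^{(2)}_i=|h_i|^{-2}h_i$ (with $0$ and $\infty$ exchanged). Put $\mathtt I_2=\{i:|h^{(2)}_i|<\rho_0\}$ and let $\mathtt B_2$ be its boundary. Here, for $s=1,2$, $L_s=[L_D]_{\mathtt I_s,\mathtt I_s}$ and $B_s=[L_D]_{\mathtt I_s,\mathtt B_s}$. Write $m_s=\#\mathtt B_s$, $P_1=[I_n]_{\mathtt B_2,\mathtt I_1}$, $P_2=[I_n]_{\mathtt B_1,\mathtt I_2}$, and $$A_s=-P_sL_s^{-1}B_s\quad(s=1,2),\qquad A_1\in\mathbb R^{m_2\times m_1},\ A_2\in\mathbb R^{m_1\times m_2}.$$ Let $[\mathbf q_1^\top,\mathbf q_2^\top]^\top$ with $\mathbf q_1\in\mathbb R^{m_2}$, $\mathbf q_2\in\mathbb R^{m_1}$ and $\mathbf q_2^\top\mathbf 1_{m_1}=1$ be a left eigenvector of $\mathcal A=\begin{bmatrix}0&A_1\\A_2&0\end{bmatrix}$ for the eigenvalue $1$. Then $$\sigma\big((A_2-\mathbf 1_{m_1}\mathbf q_1^\top)A_1\big)=\sigma\big(A_2A_1-\mathbf 1_{m_1}\mathbf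 q_2^\top\big)=(\sigma(A_2A_1)\setminus\{1\})\cup\{0\}$$ and $$\rho\big((A_2-\mathbf 1_{m_1}\mathbf q_1^\top)A_1\big)=\rho\big(A_2A_1-\mathbf 1_{m_1}\mathbf q_2^\top\big)<1,$$ where $\sigma$ denotes the set of complex eigenvalues and $\rho$ the spectral radius. -/

import Mathlib

open scoped OnePoint

noncomputable section

/-- The graph of edges of the triangles in `F`. -/
def trianglesGraph {V : Type*} (F : Finset (Finset V)) : SimpleGraph V where
  Adj i j := i ≠ j ∧ ∃ t ∈ F, i ∈ t ∧ j ∈ t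
  symm := ⟨fun _ _ h => ⟨h.1.symm, h.2.imp fun _ ht => ⟨ht.1, ht.2.2, ht.2.1⟩⟩⟩
  loopless := ⟨fun _ h => h.1 rfl⟩

/-- The link of the vertex `v`: its vertices are the neighbours of `v`, its edges are the sides
opposite to `v` of the triangles that contain `v`. -/
def linkGraph {V : Type*} (F : Finset (Finset V)) (v : V) :
    SimpleGraph {w : V // (trianglesGraph F).Adj v w} where
  Adj a b := a ≠ b ∧ ∃ t ∈ F, v ∈ t ∧ (a : V) ∈ t ∧ (b : V) ∈ t
  symm := ⟨fun _ _ h => ⟨h.1.symm, h.2.imp fun _ ht => ⟨ht.1, ht.2.1, ht.2.2.2, ht.2.2.1⟩⟩⟩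
  loopless := ⟨fun _ h => h.1 rfl⟩

/-- A connected closed triangular mesh in `ℝ³` with vertex set `V`: a finite pure two-dimensional
simplicial complex whose underlying space is a connected closed surface, together with vertex
positions for which no triangle is degenerate. -/
structure ClosedTriMesh (V : Type*) where
  /-- Positions of the vertices. -/
  pos : V → EuclideanSpace ℝ (Fin 3)
  /-- The triangles, as sets of three vertices. -/
  faces : Finset (Finset V)
  card_face : ∀ t ∈ faces, t.card = 3
  nondegenerate : ∀ t ∈ faces, AffineIndependent ℝ (fun i : {x // x ∈ t} => pos i)
  /-- Every edge lies in exactly two triangles. -/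
  edge_two_faces : ∀ i j : V, (trianglesGraph faces).Adj i j →
    {t | t ∈ faces ∧ i ∈ t ∧ j ∈ t}.ncard = 2
  /-- The link of every vertex is connected and nonempty (hence a cycle). -/
  link_connected : ∀ v : V, (linkGraph faces v).Connected
  /-- Any two vertices are joined by a path of edges. -/
  connected : (trianglesGraph faces).Connected

/-- Stereographic projection of the unit sphere from the north pole onto `ℂ ∪ {∞}`. -/
def stereoProj (p : Metric.sphere (0 : EuclideanSpace ℝ (Fin 3)) 1) : OnePoint ℂ :=
  open Classical in
  if p.1 2 = 1 then ∞ else ((⟨p.1 0 / (1 - p.1 2), p.1 1 / (1 - p.1 2)⟩ : ℂ) : OnePoint ℂ)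

/-- The inversion `z ↦ |z|⁻² z` of `ℂ ∪ {∞}`, exchanging `0` and `∞`. -/
def sphereInversion : OnePoint ℂ → OnePoint ℂ
  | OnePoint.infty => ((0 : ℂ) : OnePoint ℂ)
  | OnePoint.some z =>
    open Classical in if z = 0 then ∞ else (((‖z‖ ^ 2)⁻¹ • z : ℂ) : OnePoint ℂ)

/-- The finite value of a point of `ℂ ∪ {∞}`, with the convention `0` at `∞`. -/
def finiteValue : OnePoint ℂ → ℂ
  | OnePoint.infty => 0
  | OnePoint.some z => z

/-- The indices `i` with `|h i| < r`; the value `∞` never qualifies. -/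
def innerIdx {V : Type*} [Fintype V] (r : ℝ) (h : V → OnePoint ℂ) : Finset V :=
  open Classical in
  Finset.univ.filter fun i => ∃ z : ℂ, h i = (z : OnePoint ℂ) ∧ ‖z‖ < r

namespace ClosedTriMesh

variable {V : Type*} (M : ClosedTriMesh V)

/-- The edges `[v_i, v_j]` of the mesh. -/
def edgeGraph : SimpleGraph V := trianglesGraph M.faces

/-- Genus zero: the Euler characteristic is two. -/
def IsGenusZero : Prop :=
  (Nat.card V : ℤ) - M.edgeGraph.edgeSet.ncard + M.faces.card = 2

variable [Fintype V] [DecidableEq V]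

/-- The cotangent weight `-(cot α_ij + cot α_ji) / 2`: the sum runs over the (two) triangles
`{i, j, k}` that contain the edge, and the angle is the one at `k`. It is `0` if `i ≠ j` are not
adjacent. -/
def cotWeight (i j : V) : ℝ :=
  -(1 / 2) * ∑ t ∈ M.faces.filter (fun t => i ∈ t ∧ j ∈ t), ∑ k ∈ t \ {i, j},
    Real.cot (EuclideanGeometry.angle (M.pos i) (M.pos k) (M.pos j))

/-- The discrete Laplacian `L_D`. -/
def laplacian : Matrix V V ℝ :=
  Matrix.of fun i j => if i = j then -∑ l ∈ Finset.univ.erase i, M.cotWeight i l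
    else M.cotWeight i j

/-- The vertices outside `I` that are joined by an edge to a vertex of `I`. -/
def bdry (I : Finset V) : Finset V :=
  open Classical in
  Finset.univ.filter fun j => j ∉ I ∧ ∃ i ∈ I, M.edgeGraph.Adj i j

/-- The block `[L_D]_{I,I}`. -/
def innerBlock (I : Finset V) : Matrix {i // i ∈ I} {i // i ∈ I} ℝ :=
  M.laplacian.submatrix (fun i => i.1) (fun i => i.1)

/-- The block `[L_D]_{I,B}`, where `B` is the boundary of `I`. -/
def bdryBlock (I : Finset V) : Matrix {i // i ∈ I} {j // j ∈ M.bdry I} ℝ :=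
  M.laplacian.submatrix (fun i => i.1) (fun j => j.1)

/-- The block `[I_n]_{B,I}` of the identity matrix, where `B` is the boundary of `J`. -/
def selBlock (I J : Finset V) : Matrix {j // j ∈ M.bdry J} {i // i ∈ I} ℝ :=
  (1 : Matrix V V ℝ).submatrix (fun j => j.1) (fun i => i.1)

/-- The matrix `-P L⁻¹ B` that maps boundary values of `I` to the values, at the boundary of `J`,
of the solution of the Laplace equation in `I`. -/
def transferMatrix (I J : Finset V) : Matrix {j // j ∈ M.bdry J} {j // j ∈ M.bdry I} ℝ :=
  -(M.selBlock I J * (M.innerBlock I)⁻¹ * M.bdryBlock I)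

/-- Replace the values of `h` in `I` by the solution `-L⁻¹ B h_B` of the discrete Laplace equation
with the values of `h` on the boundary `B` of `I`. (A value `∞` on `B` has no meaning here; it is
excluded wherever this is used.) -/
def harmonicUpdate (I : Finset V) (h : V → OnePoint ℂ) : V → OnePoint ℂ := fun i =>
  if hi : i ∈ I then
    (((-((M.innerBlock I)⁻¹ * M.bdryBlock I)).map (fun x : ℝ => (x : ℂ))).mulVec
      (fun j => finiteValue (h j.1)) ⟨i, hi⟩ : ℂ)
  else h i

variable (r : ℝ) (f : V → Metric.sphere (0 : EuclideanSpace ℝ (Fin 3)) 1)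

/-- The southern index set `I_1` of the spherical map `f` and the radius `r`. -/
def southIdx : Finset V := innerIdx r fun i => stereoProj (f i)

/-- The northern index set `I_2`: solve the Laplace equation on `I_1`, then invert. -/
def northIdx : Finset V :=
  innerIdx r fun i =>
    sphereInversion (M.harmonicUpdate (southIdx r f) (fun i => stereoProj (f i)) i)

/-- The index set `B_1`, with `m_1` elements. -/
abbrev southBdry : Finset V := M.bdry (southIdx r f)

/-- The index set `B_2`, with `m_2` elements. -/
abbrev northBdry : Finset V := M.bdry (M.northIdx r f)

/-- The matrix `A_1`, of size `m_2 × m_1`. -/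
def A₁ : Matrix {j // j ∈ M.northBdry r f} {j // j ∈ M.southBdry r f} ℝ :=
  M.transferMatrix (southIdx r f) (M.northIdx r f)

/-- The matrix `A_2`, of size `m_1 × m_2`. -/
def A₂ : Matrix {j // j ∈ M.southBdry r f} {j // j ∈ M.northBdry r f} ℝ :=
  M.transferMatrix (M.northIdx r f) (southIdx r f)

/-- The block matrix with zero diagonal blocks and off-diagonal blocks `A_1`, `A_2`. -/
def blockA : Matrix ({j // j ∈ M.northBdry r f} ⊕ {j // j ∈ M.southBdry r f})
    ({j // j ∈ M.northBdry r f} ⊕ {j // j ∈ M.southBdry r f}) ℝ :=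
  Matrix.fromBlocks 0 (M.A₁ r f) (M.A₂ r f) 0

end ClosedTriMesh

/-- The set of complex eigenvalues of a real square matrix. -/
def matSpectrum {m : Type*} [Fintype m] [DecidableEq m] (A : Matrix m m ℝ) : Set ℂ :=
  spectrum ℂ (A.map (fun x : ℝ => (x : ℂ)))

/-- The spectral radius of a real square matrix: the largest modulus of a complex eigenvalue. -/
def matSpectralRadius {m : Type*} [Fintype m] [DecidableEq m] (A : Matrix m m ℝ) : ENNReal :=
  spectralRadius ℂ (A.map (fun x : ℝ => (x : ℂ)))

end

/-! The eigenvector equation gives `q₂ᵀA₂ = q₁ᵀ` and `q₁ᵀA₁ = q₂ᵀ`, so both deflated matrices equal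
`T - 1 q₂ᵀ` with `T = A₂A₁`, and `T 1 = 1`, `q₂ᵀT = q₂ᵀ`. Everything then rests on one fact: a
complex eigenvector of `T` is constant or its eigenvalue has modulus less than `1`. Deflation
(`Matrix.spectrum_sub_vecMulVec_one`) moves `1` to `0` and keeps the rest.

Cotangent weights can have either sign, so no maximum principle is used; the fact comes from energy.
`T` is one sweep of the alternating Schwarz method on the cover `I₁ ∪ I₂`. Each half sweep lowers
the Dirichlet energy by the energy of its correction, so an eigenvalue of modulus at least `1`
forces both corrections to have zero energy, hence global harmonicity
(`norm_lt_one_or_mulVec_eq_zero_of_schwarz`). Positivity of the energy holds triangle by triangle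
(`cot_quadForm_nonneg_and_eq_zero`), and connectedness makes its null vectors constant. -/

/-! ### Rank-one deflation and the spectral radius. -/

section Deflation

variable {m : Type*} [Fintype m] [DecidableEq m]

open Matrix in
theorem Matrix.mem_spectrum_iff_exists_mulVec_eq {K : Type*} [Field K] (A : Matrix m m K) (c : K) :
    c ∈ spectrum K A ↔ ∃ x : m → K, x ≠ 0 ∧ A *ᵥ x = c • x := by
  rw [← Matrix.spectrum_toLin', ← Module.End.hasEigenvalue_iff_mem_spectrum]
  constructor
  · intro h
    obtain ⟨x, hx⟩ := h.exists_hasEigenvector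
    exact ⟨x, hx.2, by simpa using hx.apply_eq_smul⟩
  · rintro ⟨x, hx, h⟩
    exact Module.End.hasEigenvalue_of_hasEigenvector
      (x := x) (Module.End.hasEigenvector_iff.2 ⟨Module.End.mem_eigenspace_iff.2 (by simpa using h), hx⟩)

open Matrix in
/-- Wielandt deflation of a geometrically simple eigenvalue `1` with right eigenvector `1`. -/
theorem Matrix.spectrum_sub_vecMulVec_one {K : Type*} [Field K] [Nonempty m] (T : Matrix m m K)
    (q : m → K) (hT : T *ᵥ 1 = 1) (hq : q ᵥ* T = q) (hq1 : q ⬝ᵥ 1 = 1)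
    (hsimple : ∀ x : m → K, T *ᵥ x = x → ∃ c : K, x = c • 1) :
    spectrum K (T - vecMulVec 1 q) = (spectrum K T \ {1}) ∪ {0} := by
  have hS : ∀ x : m → K, (T - vecMulVec 1 q) *ᵥ x = T *ᵥ x - (q ⬝ᵥ x) • 1 := by
    intro x
    rw [sub_mulVec, vecMulVec_mulVec, op_smul_eq_smul]
  have hqT : ∀ x : m → K, q ⬝ᵥ (T *ᵥ x) = q ⬝ᵥ x := by
    intro x
    rw [dotProduct_mulVec, hq]
  ext c
  simp only [Set.mem_union, Set.mem_sdiff, Set.mem_singleton_iff,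
    Matrix.mem_spectrum_iff_exists_mulVec_eq, hS]
  constructor
  · rintro ⟨x, hx, h⟩
    by_cases hc : c = 0
    · exact Or.inr hc
    -- Pairing the eigenvalue equation with `q` kills its left side, leaving `0 = c (q ⬝ᵥ x)`.
    have hqx : q ⬝ᵥ x = 0 := by
      have := congrArg (fun y => q ⬝ᵥ y) h
      simp only [dotProduct_sub, dotProduct_smul, hqT, hq1, smul_eq_mul, mul_one, sub_self] at this
      simpa [hc] using this.symm
    rw [hqx, zero_smul, sub_zero] at h
    refine Or.inl ⟨⟨x, hx, h⟩, ?_⟩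
    rintro rfl
    rw [one_smul] at h
    obtain ⟨d, rfl⟩ := hsimple x h
    rw [dotProduct_smul, hq1, smul_eq_mul, mul_one] at hqx
    simp [hqx] at hx
  · rintro (⟨⟨x, hx, h⟩, hc⟩ | rfl)
    · refine ⟨x, hx, ?_⟩
      have hqx : q ⬝ᵥ x = 0 := by
        have := hqT x
        rw [h, dotProduct_smul, smul_eq_mul] at this
        have h2 : (c - 1) * (q ⬝ᵥ x) = 0 := by rw [sub_mul, this, one_mul, sub_self]
        exact (mul_eq_zero.1 h2).resolve_left (sub_ne_zero.2 hc)
      rw [h, hqx, zero_smul, sub_zero]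
    · exact ⟨1, one_ne_zero, by rw [hT, hq1]; simp⟩

theorem Matrix.spectralRadius_lt_one (A : Matrix m m ℂ)
    (h : ∀ c ∈ spectrum ℂ A, ‖c‖ < 1) : spectralRadius ℂ A < 1 := by
  cases isEmpty_or_nonempty m
  · simp [Subsingleton.elim A 0]
  -- The spectral radius does not depend on a norm; one is chosen only to make Banach algebra theory
  -- applicable.
  let _ := Matrix.linftyOpNormedRing (n := m) (α := ℂ)
  let _ := Matrix.linftyOpNormedAlgebra (R := ℂ) (n := m) (α := ℂ)
  exact spectrum.spectralRadius_lt_of_forall_lt A (r := 1) fun k hk => by exact_mod_cast h k hk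

end Deflation

/-! ### Energy decay of the alternating Schwarz method. -/

section Schwarz

variable {V : Type*} [Fintype V]

open Matrix ComplexOrder
open scoped MatrixOrder

/-- Pythagoras: correcting `u` to be `L`-harmonic where it is changed lowers the energy by the
energy of the correction. -/
theorem Matrix.IsHermitian.energy_eq_add_of_harmonic {L : Matrix V V ℂ} (hL : L.IsHermitian)
    (u v : V → ℂ) (h : ∀ i, v i = u i ∨ (L *ᵥ v) i = 0) :
    star u ⬝ᵥ (L *ᵥ u) = star v ⬝ᵥ (L *ᵥ v) + star (u - v) ⬝ᵥ (L *ᵥ (u - v)) := by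
  have h1 : star (u - v) ⬝ᵥ (L *ᵥ v) = 0 := by
    refine Finset.sum_eq_zero fun i _ => ?_
    rcases h i with h | h <;> simp [h]
  have h2 : star v ⬝ᵥ (L *ᵥ (u - v)) = 0 := by
    have := congrArg star h1
    rwa [star_zero, star_dotProduct, star_star, star_mulVec, hL.eq, ← dotProduct_mulVec] at this
  have h3 : u = v + (u - v) := by abel
  conv_lhs => rw [h3, star_add, mulVec_add, add_dotProduct, dotProduct_add, dotProduct_add, h1, h2]
  ring

/-- An eigenvector of one sweep of the alternating Schwarz method for a positive semidefinite `L`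
has a contracting eigenvalue unless it is `L`-harmonic. -/
theorem Matrix.PosSemidef.norm_lt_one_or_mulVec_eq_zero_of_schwarz {L : Matrix V V ℂ}
    (hL : L.PosSemidef) (I₁ I₂ : Finset V) (hcover : ∀ i, i ∈ I₁ ∨ i ∈ I₂) (c : ℂ) (u v : V → ℂ)
    (huv : ∀ i ∉ I₁, v i = u i) (hv : ∀ i ∈ I₁, (L *ᵥ v) i = 0)
    (hvu : ∀ i ∉ I₂, (c • u) i = v i) (hu : ∀ i ∈ I₂, (L *ᵥ (c • u)) i = 0) :
    ‖c‖ < 1 ∨ L *ᵥ u = 0 := by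
  by_contra! hcon
  obtain ⟨hc, hne⟩ := hcon
  have e1 := hL.1.energy_eq_add_of_harmonic u v fun i => by
    by_cases hi : i ∈ I₁
    exacts [Or.inr (hv i hi), Or.inl (huv i hi)]
  have e2 := hL.1.energy_eq_add_of_harmonic v (c • u) fun i => by
    by_cases hi : i ∈ I₂
    exacts [Or.inr (hu i hi), Or.inl (hvu i hi)]
  have hscale : star (c • u) ⬝ᵥ (L *ᵥ (c • u)) = ((‖c‖ ^ 2 : ℝ) : ℂ) * (star u ⬝ᵥ (L *ᵥ u)) := by
    rw [star_smul, mulVec_smul, smul_dotProduct, dotProduct_smul, smul_eq_mul, smul_eq_mul,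
      ← mul_assoc, RCLike.star_def, Complex.conj_mul']
    push_cast
    rfl
  have pu := hL.dotProduct_mulVec_nonneg u
  have p1 := hL.dotProduct_mulVec_nonneg (u - v)
  have p2 := hL.dotProduct_mulVec_nonneg (v - c • u)
  rw [hscale] at e2
  rw [e2] at e1
  have r1 := congrArg Complex.re e1
  rw [Complex.add_re, Complex.add_re, Complex.re_ofReal_mul] at r1
  have hc2 : 1 ≤ ‖c‖ ^ 2 := one_le_pow₀ hc
  have pu' := (Complex.nonneg_iff.1 pu).1
  have p1' := (Complex.nonneg_iff.1 p1)
  have p2' := (Complex.nonneg_iff.1 p2)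
  have hmul := mul_le_mul_of_nonneg_right hc2 pu'
  -- Since `1 ≤ ‖c‖ ^ 2`, the energy has not dropped over the sweep, so neither correction carries
  -- any.
  have z1 : star (u - v) ⬝ᵥ (L *ᵥ (u - v)) = 0 :=
    Complex.ext (by simp only [Complex.zero_re]; linarith [p1'.1, p2'.1]) (by simpa using p1'.2.symm)
  have z2 : star (v - c • u) ⬝ᵥ (L *ᵥ (v - c • u)) = 0 :=
    Complex.ext (by simp only [Complex.zero_re]; linarith [p1'.1, p2'.1]) (by simpa using p2'.2.symm)
  rw [hL.dotProduct_mulVec_zero_iff, mulVec_sub, sub_eq_zero] at z1 z2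
  refine hne (funext fun i => ?_)
  rcases hcover i with hi | hi
  · rw [z1, hv i hi]; rfl
  · rw [z1, z2, hu i hi]; rfl

/-- A factorization `Bᴴ * B` survives the extension of scalars. -/
theorem Matrix.PosSemidef.map_ofReal [DecidableEq V] {L : Matrix V V ℝ} (hL : L.PosSemidef) :
    (L.map (fun x : ℝ => (x : ℂ))).PosSemidef := by
  obtain ⟨B, rfl⟩ := CStarAlgebra.nonneg_iff_eq_star_mul_self.1 hL.nonneg
  rw [star_eq_conjTranspose]
  have : (Bᴴ * B).map (fun x : ℝ => (x : ℂ))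
      = (B.map (fun x : ℝ => (x : ℂ)))ᴴ * B.map (fun x : ℝ => (x : ℂ)) := by
    ext i j
    simp [Matrix.mul_apply]
  rw [this]
  exact posSemidef_conjTranspose_mul_self _

end Schwarz

/-! ### Positivity and kernel of the cotangent Laplacian. -/

/-- The quadratic form of the cotangents of the angles of a triangle is positive definite on
triples with sum zero. -/
theorem cot_quadForm_nonneg_and_eq_zero {α β γ : ℝ} (hα : 0 < α) (hβ : 0 < β) (hγ : 0 < γ)
    (hsum : α + β + γ = Real.pi) (x y : ℝ) :
    0 ≤ Real.cot α * x ^ 2 + Real.cot β * y ^ 2 + Real.cot γ * (x + y) ^ 2 ∧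
    (Real.cot α * x ^ 2 + Real.cot β * y ^ 2 + Real.cot γ * (x + y) ^ 2 = 0 → x = 0 ∧ y = 0) := by
  have sα : 0 < Real.sin α := Real.sin_pos_of_pos_of_lt_pi hα (by linarith)
  have sβ : 0 < Real.sin β := Real.sin_pos_of_pos_of_lt_pi hβ (by linarith)
  have sγ : 0 < Real.sin γ := Real.sin_pos_of_pos_of_lt_pi hγ (by linarith)
  have hβ' : β = Real.pi - (α + γ) := by linarith
  have hs : Real.sin β = Real.sin α * Real.cos γ + Real.cos α * Real.sin γ := by
    rw [hβ', Real.sin_pi_sub, Real.sin_add]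
  have hc : Real.cos β = Real.sin α * Real.sin γ - Real.cos α * Real.cos γ := by
    rw [hβ', Real.cos_pi_sub, Real.cos_add]; ring
  set a := Real.cot α with ha
  set b := Real.cot β with hb
  set c := Real.cot γ with hc'
  have hac : 0 < a + c := by
    have : a + c = Real.sin β / (Real.sin α * Real.sin γ) := by
      rw [ha, hc', Real.cot_eq_cos_div_sin, Real.cot_eq_cos_div_sin, hs]
      field_simp
      ring
    rw [this]; positivity
  -- The identity `ab + bc + ca = 1` for the cotangents of a triangle; it is the determinant of the
  -- form, and completes the square in `key`.
  have hdet : b * (a + c) = 1 - a * c := by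
    rw [ha, hc', hb, Real.cot_eq_cos_div_sin, Real.cot_eq_cos_div_sin, Real.cot_eq_cos_div_sin]
    have : Real.cos α / Real.sin α + Real.cos γ / Real.sin γ
        = Real.sin β / (Real.sin α * Real.sin γ) := by
      rw [hs]; field_simp; ring
    rw [this, hc]
    field_simp
  have key : (a + c) * (a * x ^ 2 + b * y ^ 2 + c * (x + y) ^ 2)
      = ((a + c) * x + c * y) ^ 2 + y ^ 2 := by
    linear_combination y ^ 2 * hdet
  have hnn : 0 ≤ (a + c) * (a * x ^ 2 + b * y ^ 2 + c * (x + y) ^ 2) := by rw [key]; positivity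
  refine ⟨nonneg_of_mul_nonneg_right hnn hac, fun h0 => ?_⟩
  rw [h0, mul_zero] at key
  have hy : y = 0 := by
    have := sq_nonneg ((a + c) * x + c * y)
    exact pow_eq_zero_iff (two_ne_zero) |>.1 (le_antisymm (by linarith) (sq_nonneg y))
  subst hy
  have hx : (a + c) * x = 0 := by
    have h' : ((a + c) * x) ^ 2 = 0 := by linarith
    exact pow_eq_zero_iff (two_ne_zero) |>.1 h'
  exact ⟨(mul_eq_zero.1 hx).resolve_left hac.ne', rfl⟩

namespace ClosedTriMesh

variable {V : Type*} (M : ClosedTriMesh V) [DecidableEq V]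

/-- The Dirichlet energy of `u` on the triangle `t`, with every side counted twice. -/
noncomputable def triangleEnergy (t : Finset V) (u : V → ℝ) : ℝ :=
  ∑ i ∈ t, ∑ j ∈ t, ∑ k ∈ t \ {i, j},
    Real.cot (EuclideanGeometry.angle (M.pos i) (M.pos k) (M.pos j)) * (u i - u j) ^ 2

theorem triangleEnergy_nonneg_and_eq_zero {t : Finset V} (ht : t ∈ M.faces) (u : V → ℝ) :
    0 ≤ M.triangleEnergy t u ∧
    (M.triangleEnergy t u = 0 → ∀ i ∈ t, ∀ j ∈ t, u i = u j) := by
  have hnd := M.nondegenerate t ht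
  obtain ⟨a, b, c, hab, hac, hbc, rfl⟩ := Finset.card_eq_three.1 (M.card_face t ht)
  have hind : AffineIndependent ℝ ![M.pos a, M.pos b, M.pos c] := by
    let g : Fin 3 ↪ {x // x ∈ ({a, b, c} : Finset V)} :=
      ⟨![⟨a, by simp⟩, ⟨b, by simp⟩, ⟨c, by simp⟩], by
        intro i j hij
        fin_cases i <;> fin_cases j <;> simp_all [hab.symm, hac.symm, hbc.symm]⟩
    have := hnd.comp_embedding g
    convert this using 1
    ext i : 1
    fin_cases i <;> rfl
  rw [affineIndependent_iff_not_collinear_set] at hind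
  have h1 := EuclideanGeometry.angle_pos_of_not_collinear hind
  have h2 : 0 < EuclideanGeometry.angle (M.pos b) (M.pos c) (M.pos a) :=
    EuclideanGeometry.angle_pos_of_not_collinear (by
      rwa [show ({M.pos b, M.pos c, M.pos a} : Set _) = {M.pos a, M.pos b, M.pos c} by grind])
  have h3 : 0 < EuclideanGeometry.angle (M.pos c) (M.pos a) (M.pos b) :=
    EuclideanGeometry.angle_pos_of_not_collinear (by
      rwa [show ({M.pos c, M.pos a, M.pos b} : Set _) = {M.pos a, M.pos b, M.pos c} by grind])
  have hne : M.pos b ≠ M.pos a := by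
    intro h
    apply hind
    rw [h]
    simpa using collinear_pair ℝ (M.pos a) (M.pos c)
  have hsum := EuclideanGeometry.angle_add_angle_add_angle_eq_pi (M.pos c) hne
  have hE : M.triangleEnergy {a, b, c} u = 2 * (
      Real.cot (EuclideanGeometry.angle (M.pos b) (M.pos c) (M.pos a)) * (u a - u b) ^ 2
      + Real.cot (EuclideanGeometry.angle (M.pos c) (M.pos a) (M.pos b)) * (u b - u c) ^ 2
      + Real.cot (EuclideanGeometry.angle (M.pos a) (M.pos b) (M.pos c))
        * ((u a - u b) + (u b - u c)) ^ 2) := by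
    have d1 : ({a, b, c} : Finset V) \ {a, b} = {c} := by ext x; simp; grind
    have d2 : ({a, b, c} : Finset V) \ {b, a} = {c} := by ext x; simp; grind
    have d3 : ({a, b, c} : Finset V) \ {a, c} = {b} := by ext x; simp; grind
    have d4 : ({a, b, c} : Finset V) \ {c, a} = {b} := by ext x; simp; grind
    have d5 : ({a, b, c} : Finset V) \ {b, c} = {a} := by ext x; simp; grind
    have d6 : ({a, b, c} : Finset V) \ {c, b} = {a} := by ext x; simp; grind
    have hs : ∀ F : V → ℝ, ∑ i ∈ ({a, b, c} : Finset V), F i = F a + F b + F c := fun F => by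
      rw [Finset.sum_insert (by simp [hab, hac]), Finset.sum_pair hbc, add_assoc]
    rw [triangleEnergy, hs, hs, hs, hs, d1, d2, d3, d4, d5, d6]
    simp only [Finset.sum_singleton, sub_self, ne_eq, OfNat.ofNat_ne_zero, not_false_eq_true,
      zero_pow, mul_zero, Finset.sum_const_zero, zero_add, add_zero]
    rw [EuclideanGeometry.angle_comm (M.pos a) (M.pos c) (M.pos b),
      EuclideanGeometry.angle_comm (M.pos c) (M.pos b) (M.pos a),
      EuclideanGeometry.angle_comm (M.pos b) (M.pos a) (M.pos c)]
    ring
  have hQ := cot_quadForm_nonneg_and_eq_zero h2 h3 h1 (by linarith) (u a - u b) (u b - u c)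
  rw [hE]
  refine ⟨mul_nonneg zero_le_two hQ.1, fun h0 => ?_⟩
  obtain ⟨e1, e2⟩ := hQ.2 (by linarith)
  have e1 : u a = u b := by linarith
  have e2 : u b = u c := by linarith
  intro i hi j hj
  simp only [Finset.mem_insert, Finset.mem_singleton] at hi hj
  rcases hi with rfl | rfl | rfl <;> rcases hj with rfl | rfl | rfl <;> linarith

theorem cotWeight_comm (i j : V) : M.cotWeight i j = M.cotWeight j i := by
  unfold cotWeight
  simp only [Finset.pair_comm i j, and_comm (a := i ∈ _),
    EuclideanGeometry.angle_comm (M.pos i)]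

theorem cotWeight_eq_zero_of_not_adj {i j : V} (hij : i ≠ j) (h : ¬ M.edgeGraph.Adj i j) :
    M.cotWeight i j = 0 := by
  have : M.faces.filter (fun t => i ∈ t ∧ j ∈ t) = ∅ := by
    refine Finset.filter_eq_empty_iff.2 fun t ht hh => h ⟨hij, t, ht, hh⟩
  rw [cotWeight, this]
  simp

variable [Fintype V]

open Matrix

theorem laplacian_isSymm : M.laplacian.IsSymm := by
  ext i j
  simp only [laplacian, transpose_apply, of_apply]
  by_cases h : i = j
  · subst h; rfl
  · rw [if_neg h, if_neg (Ne.symm h), cotWeight_comm]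

theorem laplacian_mulVec_apply (u : V → ℝ) (i : V) :
    (M.laplacian *ᵥ u) i = -∑ j, M.cotWeight i j * (u i - u j) := by
  have hoff : ∑ j ∈ Finset.univ.erase i, M.laplacian i j * u j
      = ∑ j ∈ Finset.univ.erase i, M.cotWeight i j * u j :=
    Finset.sum_congr rfl fun j hj => by
      rw [laplacian, of_apply, if_neg (Finset.ne_of_mem_erase hj).symm]
  rw [mulVec, dotProduct, ← Finset.add_sum_erase _ _ (Finset.mem_univ i), hoff,
    ← Finset.add_sum_erase (a := i) _ (fun j => M.cotWeight i j * (u i - u j)) (Finset.mem_univ i)]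
  simp only [laplacian, of_apply, if_true, sub_self, mul_zero, zero_add]
  simp only [mul_sub, Finset.sum_sub_distrib, ← Finset.sum_mul]
  ring

theorem laplacian_mulVec_one : M.laplacian *ᵥ 1 = 0 := by
  ext i
  simp [laplacian_mulVec_apply]

/-- Symmetrizing in `i, j` and regrouping the edge sum by triangles; one factor `1/2` comes from the
symmetrization, the other from the weight. -/
theorem dotProduct_laplacian_mulVec (u : V → ℝ) :
    u ⬝ᵥ (M.laplacian *ᵥ u) = (1 / 4) * ∑ t ∈ M.faces, M.triangleEnergy t u := by
  have h1 : u ⬝ᵥ (M.laplacian *ᵥ u)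
      = -(1 / 2) * ∑ i, ∑ j, M.cotWeight i j * (u i - u j) ^ 2 := by
    have e1 : u ⬝ᵥ (M.laplacian *ᵥ u) = -∑ i, ∑ j, M.cotWeight i j * (u i - u j) * u i := by
      simp only [dotProduct, laplacian_mulVec_apply]
      rw [← Finset.sum_neg_distrib]
      refine Finset.sum_congr rfl fun i _ => ?_
      rw [mul_neg, Finset.mul_sum]
      congr 1
      exact Finset.sum_congr rfl fun j _ => by ring
    have e2 : ∑ i, ∑ j, M.cotWeight i j * (u i - u j) * u i
        = -∑ i, ∑ j, M.cotWeight i j * (u i - u j) * u j := by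
      rw [Finset.sum_comm, ← Finset.sum_neg_distrib]
      refine Finset.sum_congr rfl fun i _ => ?_
      rw [← Finset.sum_neg_distrib]
      exact Finset.sum_congr rfl fun j _ => by rw [M.cotWeight_comm]; ring
    have e3 : ∑ i, ∑ j, M.cotWeight i j * (u i - u j) ^ 2
        = ∑ i, ∑ j, M.cotWeight i j * (u i - u j) * u i
          - ∑ i, ∑ j, M.cotWeight i j * (u i - u j) * u j := by
      simp only [← Finset.sum_sub_distrib]
      exact Finset.sum_congr rfl fun i _ => Finset.sum_congr rfl fun j _ => by ring
    linarith
  have h2 : ∑ i, ∑ j, M.cotWeight i j * (u i - u j) ^ 2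
      = -(1 / 2) * ∑ t ∈ M.faces, M.triangleEnergy t u := by
    simp only [cotWeight, triangleEnergy, mul_assoc, ← Finset.mul_sum, Finset.sum_mul]
    congr 1
    simp only [Finset.sum_filter]
    rw [Finset.sum_congr rfl fun i _ => Finset.sum_comm, Finset.sum_comm]
    refine Finset.sum_congr rfl fun t _ => ?_
    rw [← Finset.sum_subset (Finset.subset_univ t) (fun i _ hi => by simp [hi])]
    refine Finset.sum_congr rfl fun i hi => ?_
    rw [← Finset.sum_subset (Finset.subset_univ t) (fun i _ hi => by simp [hi])]
    exact Finset.sum_congr rfl fun j hj => by simp [hi, hj]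
  rw [h1, h2]
  ring

theorem posSemidef_laplacian : M.laplacian.PosSemidef := by
  refine .of_dotProduct_mulVec_nonneg ?_ fun u => ?_
  · rw [IsHermitian, conjTranspose_eq_transpose_of_trivial]
    exact M.laplacian_isSymm
  · rw [star_trivial, dotProduct_laplacian_mulVec]
    exact mul_nonneg (by norm_num)
      (Finset.sum_nonneg fun t ht => (M.triangleEnergy_nonneg_and_eq_zero ht u).1)

/-- The energy vanishes term by term, so `u` is constant on each triangle and, by connectedness,
everywhere. The disjunction covers both global harmonicity and zero Dirichlet data. -/
theorem eq_of_laplacian_mulVec_eq_zero_on_support {u : V → ℝ}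
    (h : ∀ i, u i = 0 ∨ (M.laplacian *ᵥ u) i = 0) (i j : V) : u i = u j := by
  have h0 : u ⬝ᵥ (M.laplacian *ᵥ u) = 0 :=
    Finset.sum_eq_zero fun i _ => mul_eq_zero.2 (h i)
  rw [dotProduct_laplacian_mulVec] at h0
  have h1 := (Finset.sum_eq_zero_iff_of_nonneg fun t ht =>
    (M.triangleEnergy_nonneg_and_eq_zero ht u).1).1 ((mul_eq_zero.1 h0).resolve_left (by norm_num))
  obtain ⟨p⟩ := M.connected.preconnected i j
  induction p with
  | nil => rfl
  | cons hadj _ ih =>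
    obtain ⟨-, t, ht, hi, hj⟩ := hadj
    exact ((M.triangleEnergy_nonneg_and_eq_zero ht u).2 (h1 t ht) _ hi _ hj).trans ih

theorem eq_of_laplacian_map_mulVec_eq_zero {u : V → ℂ}
    (h : M.laplacian.map (fun x : ℝ => (x : ℂ)) *ᵥ u = 0) (i j : V) : u i = u j := by
  have hre : ∀ i, (M.laplacian *ᵥ fun i => (u i).re) i = 0 := fun i => by
    have := congrArg Complex.re (congrFun h i)
    simpa [mulVec, dotProduct] using this
  have him : ∀ i, (M.laplacian *ᵥ fun i => (u i).im) i = 0 := fun i => by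
    have := congrArg Complex.im (congrFun h i)
    simpa [mulVec, dotProduct] using this
  exact Complex.ext
    (M.eq_of_laplacian_mulVec_eq_zero_on_support (fun i => Or.inr (hre i)) i j)
    (M.eq_of_laplacian_mulVec_eq_zero_on_support (fun i => Or.inr (him i)) i j)

/-- A kernel vector extended by zero has zero energy, hence is constant, and it vanishes at `b`. -/
theorem isUnit_innerBlock {I : Finset V} (hI : ∃ b, b ∉ I) : IsUnit (M.innerBlock I) := by
  rw [← mulVec_injective_iff_isUnit]
  intro v w hvw
  rw [← sub_eq_zero]
  have h0 : M.innerBlock I *ᵥ (v - w) = 0 := by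
    rw [mulVec_sub, sub_eq_zero]; exact hvw
  set x := v - w
  obtain ⟨b, hb⟩ := hI
  let u : V → ℝ := fun i => if hi : i ∈ I then x ⟨i, hi⟩ else 0
  have hu : ∀ i : {i // i ∈ I}, u i = x i := fun i => by simp [u]
  have hL : ∀ i, u i = 0 ∨ (M.laplacian *ᵥ u) i = 0 := by
    intro i
    by_cases hi : i ∈ I
    · right
      refine Eq.trans ?_ (congrFun h0 ⟨i, hi⟩)
      simp only [mulVec, dotProduct, innerBlock, submatrix_apply]
      rw [← Finset.sum_subset (Finset.subset_univ I) (fun j _ hj => by simp [u, hj]),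
        ← Finset.sum_coe_sort]
      exact Finset.sum_congr rfl fun j _ => by rw [hu]
    · exact Or.inl (by simp [u, hi])
  ext i
  rw [← hu, M.eq_of_laplacian_mulVec_eq_zero_on_support hL i b]
  simp [u, hb]

end ClosedTriMesh

/-! ### The cover by the two index sets, and discrete harmonic extension. -/

theorem mem_innerIdx_coe {V : Type*} [Fintype V] {r : ℝ} {h : V → OnePoint ℂ} {i : V} {z : ℂ}
    (hz : h i = (z : OnePoint ℂ)) : i ∈ innerIdx r h ↔ ‖z‖ < r := by
  classical
  simp only [innerIdx, Finset.mem_filter]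
  refine ⟨?_, fun h' => ⟨Finset.mem_univ _, z, hz, h'⟩⟩
  rintro ⟨-, w, hw, hlt⟩
  rw [hz, OnePoint.coe_eq_coe] at hw
  rwa [hw]

namespace ClosedTriMesh

variable {V : Type*} (M : ClosedTriMesh V) [Fintype V] [DecidableEq V]

open Matrix

/-- The update leaves vertices outside `I₁` alone, and inversion sends modulus at least `r` to at
most `1 / r < r`. -/
theorem mem_southIdx_or_mem_northIdx {r : ℝ} (hr : 1 < r)
    (f : V → Metric.sphere (0 : EuclideanSpace ℝ (Fin 3)) 1) (i : V) :
    i ∈ southIdx r f ∨ i ∈ M.northIdx r f := by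
  by_cases hi : i ∈ southIdx r f
  · exact Or.inl hi
  refine Or.inr ?_
  have hupd : M.harmonicUpdate (southIdx r f) (fun i => stereoProj (f i)) i = stereoProj (f i) := by
    simp only [harmonicUpdate, dif_neg hi]
  cases hs : stereoProj (f i) with
  | infty =>
    have : sphereInversion (M.harmonicUpdate (southIdx r f) (fun i => stereoProj (f i)) i)
        = ((0 : ℂ) : OnePoint ℂ) := by rw [hupd, hs]; rfl
    rw [northIdx, mem_innerIdx_coe (h := fun i => sphereInversion
      (M.harmonicUpdate (southIdx r f) (fun i => stereoProj (f i)) i)) this, norm_zero]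
    linarith
  | coe z =>
    rw [southIdx, mem_innerIdx_coe (h := fun i => stereoProj (f i)) hs, not_lt] at hi
    have hz : 1 < ‖z‖ := hr.trans_le hi
    have hz0 : z ≠ 0 := by
      rintro rfl
      rw [norm_zero] at hz
      linarith
    have : sphereInversion (M.harmonicUpdate (southIdx r f) (fun i => stereoProj (f i)) i)
        = (((‖z‖ ^ 2)⁻¹ • z : ℂ) : OnePoint ℂ) := by
      rw [hupd, hs]
      exact if_neg hz0
    rw [northIdx, mem_innerIdx_coe (h := fun i => sphereInversion
      (M.harmonicUpdate (southIdx r f) (fun i => stereoProj (f i)) i)) this, norm_smul, norm_inv, norm_pow, norm_norm]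
    have : (‖z‖ ^ 2)⁻¹ * ‖z‖ = ‖z‖⁻¹ := by
      field_simp
    rw [this]
    exact (inv_lt_one_of_one_lt₀ hz).trans hr

theorem mem_bdry {I : Finset V} {j : V} :
    j ∈ M.bdry I ↔ j ∉ I ∧ ∃ i ∈ I, M.edgeGraph.Adj i j := by
  simp [bdry]

theorem laplacian_mulVec_apply_of_mem {I : Finset V} (u : V → ℂ) (i : {i // i ∈ I}) :
    (M.laplacian.map (fun x : ℝ => (x : ℂ)) *ᵥ u) i =
      ((M.innerBlock I).map (fun x : ℝ => (x : ℂ)) *ᵥ fun j => u j.1) i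
        + ((M.bdryBlock I).map (fun x : ℝ => (x : ℂ)) *ᵥ fun j => u j.1) i := by
  simp only [mulVec, dotProduct, innerBlock, bdryBlock, submatrix_apply, map_apply]
  rw [Finset.sum_coe_sort I (fun j => ((M.laplacian i j : ℝ) : ℂ) * u j),
    Finset.sum_coe_sort (M.bdry I) (fun j => ((M.laplacian i j : ℝ) : ℂ) * u j),
    ← Finset.sum_union (Finset.disjoint_right.2 fun j hj => (M.mem_bdry.1 hj).1)]
  refine (Finset.sum_subset (Finset.subset_univ _) fun j _ hj => ?_).symm
  rw [Finset.mem_union, not_or, mem_bdry] at hj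
  have hij : (i : V) ≠ j := fun h => hj.1 (h ▸ i.2)
  have hadj : ¬ M.edgeGraph.Adj i j := fun h => hj.2 ⟨hj.1, i, i.2, h⟩
  rw [laplacian, of_apply, if_neg hij, M.cotWeight_eq_zero_of_not_adj hij hadj]
  simp

/-- The values in `I` of the discrete harmonic function with boundary values `x`. -/
noncomputable def harmonicExt (I : Finset V) (x : {j // j ∈ M.bdry I} → ℂ) : {i // i ∈ I} → ℂ :=
  (-((M.innerBlock I)⁻¹ * M.bdryBlock I)).map (fun x : ℝ => (x : ℂ)) *ᵥ x

theorem _root_.Matrix.map_ofReal_mul {l m n : Type*} [Fintype m] (A : Matrix l m ℝ)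
    (B : Matrix m n ℝ) :
    (A * B).map (fun x : ℝ => (x : ℂ))
      = A.map (fun x : ℝ => (x : ℂ)) * B.map (fun x : ℝ => (x : ℂ)) :=
  Matrix.map_mul (f := Complex.ofRealHom)

theorem innerBlock_mulVec_harmonicExt {I : Finset V} (hI : ∃ b, b ∉ I)
    (x : {j // j ∈ M.bdry I} → ℂ) :
    (M.innerBlock I).map (fun x : ℝ => (x : ℂ)) *ᵥ M.harmonicExt I x
      = -((M.bdryBlock I).map (fun x : ℝ => (x : ℂ)) *ᵥ x) := by
  have hdet := (isUnit_iff_isUnit_det _).1 (M.isUnit_innerBlock hI)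
  rw [harmonicExt, mulVec_mulVec, ← Matrix.map_ofReal_mul, Matrix.mul_neg, ← Matrix.mul_assoc,
    mul_nonsing_inv _ hdet, Matrix.one_mul, ← neg_mulVec]
  congr 1
  ext
  simp

theorem laplacian_mulVec_eq_zero_of_harmonicExt {I : Finset V} (hI : ∃ b, b ∉ I)
    {x : {j // j ∈ M.bdry I} → ℂ} {u : V → ℂ} (hu : ∀ i : {i // i ∈ I}, u i = M.harmonicExt I x i)
    (hx : ∀ j : {j // j ∈ M.bdry I}, u j = x j) :
    ∀ i ∈ I, (M.laplacian.map (fun x : ℝ => (x : ℂ)) *ᵥ u) i = 0 := by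
  intro i hi
  rw [M.laplacian_mulVec_apply_of_mem u ⟨i, hi⟩, funext hu, funext hx,
    M.innerBlock_mulVec_harmonicExt hI]
  simp

theorem laplacian_map_mulVec_one : M.laplacian.map (fun x : ℝ => (x : ℂ)) *ᵥ 1 = 0 := by
  ext i
  have := congrArg (fun x : ℝ => (x : ℂ)) (congrFun M.laplacian_mulVec_one i)
  simpa [mulVec, dotProduct] using this

/-- Constants are harmonic, and the Dirichlet problem has a unique solution. -/
theorem harmonicExt_one {I : Finset V} (hI : ∃ b, b ∉ I) : M.harmonicExt I 1 = 1 := by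
  have hdet := (isUnit_iff_isUnit_det _).1 (M.isUnit_innerBlock hI)
  have hone : (M.innerBlock I).map (fun x : ℝ => (x : ℂ)) *ᵥ 1
      = -((M.bdryBlock I).map (fun x : ℝ => (x : ℂ)) *ᵥ 1) := by
    ext i
    have := M.laplacian_mulVec_apply_of_mem 1 i
    rw [M.laplacian_map_mulVec_one] at this
    exact eq_neg_of_add_eq_zero_left this.symm
  rw [← M.innerBlock_mulVec_harmonicExt hI] at hone
  have hinv : (M.innerBlock I)⁻¹.map (fun x : ℝ => (x : ℂ))
      * (M.innerBlock I).map (fun x : ℝ => (x : ℂ)) = 1 := by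
    rw [← Matrix.map_ofReal_mul, nonsing_inv_mul _ hdet]
    exact Matrix.map_one _ Complex.ofReal_zero Complex.ofReal_one
  have := congrArg (fun y => (M.innerBlock I)⁻¹.map (fun x : ℝ => (x : ℂ)) *ᵥ y) hone
  simpa only [mulVec_mulVec, hinv, one_mulVec] using this.symm

theorem transferMatrix_mulVec_apply {I J : Finset V} (x : {j // j ∈ M.bdry I} → ℂ)
    (j : {j // j ∈ M.bdry J}) (hj : (j : V) ∈ I) :
    ((M.transferMatrix I J).map (fun x : ℝ => (x : ℂ)) *ᵥ x) j = M.harmonicExt I x ⟨j, hj⟩ := by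
  have hrow : ∀ k, M.transferMatrix I J j k
      = (-((M.innerBlock I)⁻¹ * M.bdryBlock I)) ⟨j, hj⟩ k := fun k => by
    rw [transferMatrix, Matrix.mul_assoc, neg_apply, neg_apply, Matrix.mul_apply,
      Finset.sum_eq_single ⟨(j : V), hj⟩]
    · simp [selBlock]
    · intro b _ hb
      have : (j : V) ≠ b := fun h => hb (Subtype.ext h.symm)
      simp [selBlock, Matrix.one_apply_ne this]
    · simp
  simp only [harmonicExt, mulVec, dotProduct, map_apply, hrow]

theorem transferMatrix_mulVec_one {I J : Finset V} (hI : ∃ b, b ∉ I) (hIJ : M.bdry J ⊆ I) :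
    (M.transferMatrix I J).map (fun x : ℝ => (x : ℂ)) *ᵥ 1 = 1 := by
  ext j
  rw [M.transferMatrix_mulVec_apply 1 j (hIJ j.2), M.harmonicExt_one hI]
  rfl

theorem bdry_subset_of_cover {I J : Finset V} (h : ∀ i, i ∈ I ∨ i ∈ J) : M.bdry I ⊆ J :=
  fun j hj => (h j).resolve_left (M.mem_bdry.1 hj).1

/-- The alternating Schwarz iteration contracts every eigenvector that is not constant. -/
theorem norm_lt_one_or_const_of_transferMatrix_mulVec_eq {I J : Finset V} (hI : ∃ b, b ∉ I)
    (hJ : ∃ b, b ∉ J) (hIJ : ∀ i, i ∈ I ∨ i ∈ J) {c : ℂ} {x : {j // j ∈ M.bdry I} → ℂ}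
    (hx : (M.transferMatrix J I * M.transferMatrix I J).map (fun x : ℝ => (x : ℂ)) *ᵥ x = c • x) :
    ‖c‖ < 1 ∨ ∃ d : ℂ, x = d • 1 := by
  by_cases hc : c = 0
  · left; simp [hc]
  rw [Matrix.map_ofReal_mul, ← mulVec_mulVec] at hx
  have hBI := M.bdry_subset_of_cover hIJ
  have hBJ := M.bdry_subset_of_cover fun i => (hIJ i).symm
  set y := (M.transferMatrix I J).map (fun x : ℝ => (x : ℂ)) *ᵥ x with hy
  -- An eigenvector on `bdry I` becomes an eigenvector of a full sweep: `c⁻¹ • w` agrees with `x` on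
  -- `bdry I`, solving in `I` turns it into `v`, and solving in `J` turns `v` into `w`.
  let w : V → ℂ := fun i => if hi : i ∈ J then M.harmonicExt J y ⟨i, hi⟩ else
    M.harmonicExt I x ⟨i, (hIJ i).resolve_right hi⟩
  let v : V → ℂ := fun i => if hi : i ∈ I then M.harmonicExt I x ⟨i, hi⟩ else c⁻¹ * w i
  have hcw : c • (c⁻¹ • w) = w := smul_inv_smul₀ hc w
  have hwx : ∀ j : {j // j ∈ M.bdry I}, c⁻¹ * w j = x j := fun j => by
    have h1 : w j = c * x j := by
      have := congrFun hx j
      rw [M.transferMatrix_mulVec_apply y j (hBI j.2)] at this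
      simpa [w, hBI j.2] using this
    rw [h1, inv_mul_cancel_left₀ hc]
  have hv : ∀ i ∈ I, (M.laplacian.map (fun x : ℝ => (x : ℂ)) *ᵥ v) i = 0 :=
    M.laplacian_mulVec_eq_zero_of_harmonicExt hI (x := x) (fun i => by simp [v])
      (fun j => by
        simp only [v, dif_neg (M.mem_bdry.1 j.2).1]
        exact hwx j)
  have hw : ∀ i ∈ J, (M.laplacian.map (fun x : ℝ => (x : ℂ)) *ᵥ w) i = 0 :=
    M.laplacian_mulVec_eq_zero_of_harmonicExt hJ (x := y) (fun i => by simp [w])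
      (fun j => by
        simp only [w, dif_neg (M.mem_bdry.1 j.2).1]
        exact (M.transferMatrix_mulVec_apply x j (hBJ j.2)).symm)
  refine (M.posSemidef_laplacian.map_ofReal.norm_lt_one_or_mulVec_eq_zero_of_schwarz I J hIJ c
    (c⁻¹ • w) v (fun i hi => by simp [v, hi]) hv (fun i hi => ?_) (by rwa [hcw])).imp_right
      fun h => ?_
  · rw [hcw]
    simp [w, v, hi, (hIJ i).resolve_right hi]
  · obtain ⟨b, -⟩ := hI
    refine ⟨(c⁻¹ • w) b, funext fun j => ?_⟩
    rw [← hwx j, Pi.smul_apply, Pi.one_apply, smul_eq_mul, mul_one]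
    exact M.eq_of_laplacian_map_mulVec_eq_zero h j b

end ClosedTriMesh

/-! ### Assembly of the theorem. -/

open Matrix in
theorem mainTheorem2 {V : Type*} [Fintype V] [DecidableEq V]
    (M : ClosedTriMesh V) (hM : M.IsGenusZero)
    (f : V → Metric.sphere (0 : EuclideanSpace ℝ (Fin 3)) 1)
    (r : ℝ) (hr : 1 < r)
    (hfin : ∀ j ∈ M.southBdry r f, stereoProj (f j) ≠ OnePoint.infty)
    (q₁ : {j // j ∈ M.northBdry r f} → ℝ) (q₂ : {j // j ∈ M.southBdry r f} → ℝ)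
    (hq : Matrix.vecMul (Sum.elim q₁ q₂) (M.blockA r f) = (1 : ℝ) • Sum.elim q₁ q₂)
    (hq₂ : q₂ ⬝ᵥ 1 = 1) :
    (matSpectrum ((M.A₂ r f - Matrix.vecMulVec 1 q₁) * M.A₁ r f)
        = matSpectrum (M.A₂ r f * M.A₁ r f - Matrix.vecMulVec 1 q₂) ∧
      matSpectrum (M.A₂ r f * M.A₁ r f - Matrix.vecMulVec 1 q₂)
        = (matSpectrum (M.A₂ r f * M.A₁ r f) \ {1}) ∪ {0}) ∧
    matSpectralRadius ((M.A₂ r f - Matrix.vecMulVec 1 q₁) * M.A₁ r f)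
      = matSpectralRadius (M.A₂ r f * M.A₁ r f - Matrix.vecMulVec 1 q₂) ∧
    matSpectralRadius (M.A₂ r f * M.A₁ r f - Matrix.vecMulVec 1 q₂) < 1 := by
  rw [ClosedTriMesh.blockA, vecMul_fromBlocks, one_smul] at hq
  have hq1 : q₂ ᵥ* M.A₂ r f = q₁ := by
    ext j
    simpa using congrFun hq (Sum.inl j)
  have hq2 : q₁ ᵥ* M.A₁ r f = q₂ := by
    ext j
    simpa using congrFun hq (Sum.inr j)
  have hcover := M.mem_southIdx_or_mem_northIdx hr f
  -- The normalization of `q₂` excludes empty boundaries, so each index set misses a vertex and its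
  -- inner block is invertible.
  have : Nonempty {j // j ∈ M.southBdry r f} := by
    by_contra h
    rw [not_nonempty_iff] at h
    simp [dotProduct] at hq₂
  have hne : Nonempty {j // j ∈ M.northBdry r f} := by
    by_contra h
    rw [not_nonempty_iff] at h
    have : q₂ = 0 := by
      rw [← hq2]
      ext j
      simp [vecMul, dotProduct]
    simp [this] at hq₂
  have hI : ∃ b, b ∉ ClosedTriMesh.southIdx r f := this.elim fun j => ⟨j, (M.mem_bdry.1 j.2).1⟩
  have hJ : ∃ b, b ∉ M.northIdx r f := hne.elim fun j => ⟨j, (M.mem_bdry.1 j.2).1⟩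
  have heq : (M.A₂ r f - vecMulVec 1 q₁) * M.A₁ r f = M.A₂ r f * M.A₁ r f - vecMulVec 1 q₂ := by
    rw [Matrix.sub_mul, vecMulVec_mul, hq2]
  have hconst : ∀ (c : ℂ) (x : {j // j ∈ M.southBdry r f} → ℂ),
      (M.A₂ r f * M.A₁ r f).map (fun x : ℝ => (x : ℂ)) *ᵥ x = c • x →
        ‖c‖ < 1 ∨ ∃ d : ℂ, x = d • 1 :=
    fun c x hx => M.norm_lt_one_or_const_of_transferMatrix_mulVec_eq hI hJ hcover hx
  have hone : (M.A₂ r f * M.A₁ r f).map (fun x : ℝ => (x : ℂ)) *ᵥ 1 = 1 := by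
    rw [Matrix.map_ofReal_mul, ← mulVec_mulVec, ClosedTriMesh.A₁, ClosedTriMesh.A₂,
      M.transferMatrix_mulVec_one hI (M.bdry_subset_of_cover fun i => (hcover i).symm),
      M.transferMatrix_mulVec_one hJ (M.bdry_subset_of_cover hcover)]
  have hqT : q₂ ᵥ* (M.A₂ r f * M.A₁ r f) = q₂ := by
    rw [← vecMul_vecMul, hq1, hq2]
  have hmap : (M.A₂ r f * M.A₁ r f - vecMulVec 1 q₂).map (fun x : ℝ => (x : ℂ))
      = (M.A₂ r f * M.A₁ r f).map (fun x : ℝ => (x : ℂ))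
        - vecMulVec 1 (fun j => (q₂ j : ℂ)) := by
    ext i j
    simp
  have hspec : matSpectrum (M.A₂ r f * M.A₁ r f - vecMulVec 1 q₂)
      = (matSpectrum (M.A₂ r f * M.A₁ r f) \ {1}) ∪ {0} := by
    rw [matSpectrum, matSpectrum, hmap]
    refine Matrix.spectrum_sub_vecMulVec_one _ _ hone ?_ ?_ fun x hx => ?_
    · ext j
      have := congrArg (fun x : ℝ => (x : ℂ)) (congrFun hqT j)
      simpa only [vecMul, dotProduct, map_apply, Complex.ofReal_sum, Complex.ofReal_mul] using this
    · have := congrArg (fun x : ℝ => (x : ℂ)) hq₂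
      simpa [dotProduct] using this
    · exact (hconst 1 x (by rw [hx, one_smul])).resolve_left (by simp)
  refine ⟨⟨by rw [heq], hspec⟩, by rw [heq], ?_⟩
  refine Matrix.spectralRadius_lt_one _ fun c hc => ?_
  change c ∈ matSpectrum _ at hc
  rw [hspec] at hc
  rcases hc with ⟨hc, hc1⟩ | rfl
  · obtain ⟨x, hx0, hx⟩ := (Matrix.mem_spectrum_iff_exists_mulVec_eq _ _).1 hc
    refine (hconst c x hx).resolve_right ?_
    -- A constant eigenvector would give `c = 1`, the eigenvalue that deflation removed.
    rintro ⟨d, rfl⟩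
    rw [mulVec_smul, hone] at hx
    have hd : d ≠ 0 := by
      rintro rfl
      simp at hx0
    obtain ⟨j⟩ := this
    have := congrFun hx j
    simp only [Pi.smul_apply, Pi.one_apply, smul_eq_mul, mul_one] at this
    exact hc1 (mul_right_cancel₀ hd (by rw [← this, one_mul]))
  · simp
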